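/- Let $G$ be a topological group. Let $\mathsf{LUCB}(G)$ be the space of bounded functions $f\colon G\to\mathbb R$ such that for every $\epsilon>0$ there is an identity neighbourhood $V\subseteq G$ with $|f(gv)-f(g)|<\epsilon$ for all $g\in G$, $v\in V$. A mean on $\mathsf{LUCB}(G)$ is a positive linear functional $m\colon\mathsf{LUCB}(G)\to\mathbb R$ with $\|m\|=m(1)=1$. The group $G$ is called amenable if there is a mean $m$ with $m(f(\,\cdot\,g))=m(f)$ for all $g\in G$ and $f\in\mathsf{LUCB}(G)$, and skew-amenable if there is a mean $n$ with $n(f(g^{-1}\,\cdot\,))=n(f)$ for all $g\in G$ and $f\in\mathsf{LUCB}(G)$. For a metric space $(X,d)$, let $\mathsf{Lip}\,X$ be the vector space of Lipschitz functions $X\to\mathbb R$ and let $\mathfrak{Lip}\,X=\mathsf{Lip}\,X/\{\text{constant functions}\}$, normed by the optimal Lipschitz constant $L(\phi)=\sup_{x\ne y}|\phi(x)-\phi(y)|/d(x,y)$. If $G$ acts by isometries on $X$, let $X/\!\!/G=\{\overline{Gx}\mid x\in X\}$ be the set of closures of orbits, which is a metric space under the Hausdorff distance. **Theorem.** Suppose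 $G$ is an amenable and skew-amenable topological group and $G\curvearrowright X$ is a continuous action by isometries on a metric space $X$. Assume furthermore that either $X$ has finite diameter or that $G$ has no non-trivial continuous homomorphisms to $\mathbb R$. Then there is a linear operator $$S\colon \mathfrak{Lip}\,X\to\mathfrak{Lip}(X/\!\!/G)$$ such that 1. $S$ is a contraction, i.e., $\|S\|\leqslant 1$; 2. $S$ is $G$-invariant, i.e., $S\big(\phi(g^{-1}\,\cdot\,)\big)=S\phi$ for all $g\in G$ and $\phi\in\mathfrak{Lip}\,X$; 3. $(S\phi)(\overline{Gx})=\phi(x)$ whenever $\phi$ is constant on every orbit; that is, if $\phi\in\mathsf{Lip}\,X$ is constant on every $G$-orbit, then $S$ maps the class of $\phi$ to the class of a Lipschitz function $\psi$ on $X/\!\!/G$ with $\psi(\overline{Gx})=\phi(x)$ for all $x\in X$. -/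

import Mathlib

open Topology

noncomputable section

/-! ### Bounded left-uniformly continuous functions, means, (skew-)amenability -/

section Amenability

variable (G : Type*) [Group G] [TopologicalSpace G] [IsTopologicalGroup G]

/-- `LUCB G`: the bounded functions `φ : G → ℝ` such that for every `ε > 0` there is a neighbourhood
`V` of the identity with `|φ (g v) - φ g| < ε` for all `g : G`, `v ∈ V`; that is, those bounded `φ`
for which `g ↦ φ (· g)` is continuous for the supremum norm. -/
def LUCB : Submodule ℝ (G → ℝ) where
  carrier := {φ | (∃ C : ℝ, ∀ g, |φ g| ≤ C) ∧
    ∀ ε > 0, ∃ V ∈ 𝓝 (1 : G), ∀ g, ∀ v ∈ V, |φ (g * v) - φ g| < ε}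
  zero_mem' := ⟨⟨0, by simp⟩, fun ε hε => ⟨Set.univ, Filter.univ_mem, by simpa using hε⟩⟩
  add_mem' := by
    rintro φ ψ ⟨⟨C, hC⟩, hφ⟩ ⟨⟨D, hD⟩, hψ⟩
    refine ⟨⟨C + D, fun g => (abs_add_le _ _).trans (add_le_add (hC g) (hD g))⟩, fun ε hε => ?_⟩
    obtain ⟨V, hV, h1⟩ := hφ (ε / 2) (half_pos hε)
    obtain ⟨W, hW, h2⟩ := hψ (ε / 2) (half_pos hε)
    refine ⟨V ∩ W, Filter.inter_mem hV hW, fun g v hv => ?_⟩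
    have e : (φ + ψ) (g * v) - (φ + ψ) g = (φ (g * v) - φ g) + (ψ (g * v) - ψ g) := by
      simp only [Pi.add_apply]; ring
    rw [e]
    have := abs_add_le (φ (g * v) - φ g) (ψ (g * v) - ψ g)
    linarith [h1 g v hv.1, h2 g v hv.2]
  smul_mem' := by
    rintro c φ ⟨⟨C, hC⟩, hφ⟩
    refine ⟨⟨|c| * C, fun g => ?_⟩, fun ε hε => ?_⟩
    · rw [Pi.smul_apply, smul_eq_mul, abs_mul]
      exact mul_le_mul_of_nonneg_left (hC g) (abs_nonneg c)
    · have hc : 0 < |c| + 1 := by positivity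
      obtain ⟨V, hV, h1⟩ := hφ (ε / (|c| + 1)) (div_pos hε hc)
      refine ⟨V, hV, fun g v hv => ?_⟩
      have e : (c • φ) (g * v) - (c • φ) g = c * (φ (g * v) - φ g) := by
        simp only [Pi.smul_apply, smul_eq_mul]; ring
      rw [e, abs_mul]
      have h2 := (lt_div_iff₀ hc).1 (h1 g v hv)
      nlinarith [abs_nonneg (φ (g * v) - φ g), abs_nonneg c]

variable {G}

namespace LUCB

/-- The constant function `1`. -/
def one : LUCB G :=
  ⟨fun _ => 1, ⟨1, by simp⟩, fun ε hε => ⟨Set.univ, Filter.univ_mem, by simpa using hε⟩⟩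

/-- Right translation `ρ(g) φ = φ (· g)`. -/
def rho (g : G) (φ : LUCB G) : LUCB G :=
  ⟨fun x => φ.1 (x * g), by
    obtain ⟨φ, ⟨C, hC⟩, hφ⟩ := φ
    refine ⟨⟨C, fun x => hC _⟩, fun ε hε => ?_⟩
    obtain ⟨V, hV, h⟩ := hφ ε hε
    have ht : Filter.Tendsto (fun v : G => g⁻¹ * v * g) (𝓝 1) (𝓝 1) := by
      have : Continuous fun v : G => g⁻¹ * v * g := by fun_prop
      simpa using this.tendsto 1
    refine ⟨_, ht hV, fun x v hv => ?_⟩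
    have := h (x * g) _ hv
    simpa [mul_assoc] using this⟩

/-- Left translation `λ(g) φ = φ (g⁻¹ ·)`. -/
def lam (g : G) (φ : LUCB G) : LUCB G :=
  ⟨fun x => φ.1 (g⁻¹ * x), by
    obtain ⟨φ, ⟨C, hC⟩, hφ⟩ := φ
    refine ⟨⟨C, fun x => hC _⟩, fun ε hε => ?_⟩
    obtain ⟨V, hV, h⟩ := hφ ε hε
    refine ⟨V, hV, fun x v hv => ?_⟩
    have := h (g⁻¹ * x) v hv
    simpa [mul_assoc] using this⟩

/-- A mean on `LUCB G`: a positive linear functional with `m 1 = 1`. Such a functional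
automatically has norm `1`, see `LUCB.IsMean.abs_apply_le`. -/
structure IsMean (m : LUCB G →ₗ[ℝ] ℝ) : Prop where
  nonneg : ∀ φ : LUCB G, (∀ g, 0 ≤ φ.1 g) → 0 ≤ m φ
  map_one : m one = 1

theorem IsMean.abs_apply_le {m : LUCB G →ₗ[ℝ] ℝ} (hm : IsMean m) (φ : LUCB G) (C : ℝ)
    (hC : ∀ g, |φ.1 g| ≤ C) : |m φ| ≤ C := by
  have h1 := hm.nonneg (C • one - φ) fun g => by
    have := (abs_le.1 (hC g)).2
    simpa [one] using this
  have h2 := hm.nonneg (C • one + φ) fun g => by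
    have := (abs_le.1 (hC g)).1
    simp only [one, Submodule.coe_add, Submodule.coe_smul, Pi.add_apply, Pi.smul_apply,
      smul_eq_mul, mul_one]
    linarith
  simp only [map_sub, map_add, map_smul, hm.map_one, smul_eq_mul, mul_one] at h1 h2
  exact abs_le.2 ⟨by linarith, by linarith⟩

end LUCB

variable (G)

/-- `G` is amenable: there is a `ρ`-invariant mean on `LUCB G`. -/
def IsAmenableGroup : Prop :=
  ∃ m : LUCB G →ₗ[ℝ] ℝ, LUCB.IsMean m ∧ ∀ (g : G) (φ : LUCB G), m (LUCB.rho g φ) = m φ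

/-- `G` is skew-amenable: there is a `λ`-invariant mean on `LUCB G`. -/
def IsSkewAmenableGroup : Prop :=
  ∃ n : LUCB G →ₗ[ℝ] ℝ, LUCB.IsMean n ∧ ∀ (g : G) (φ : LUCB G), n (LUCB.lam g φ) = n φ

end Amenability

/-! ### Lipschitz functions, and Lipschitz functions modulo constants -/

section Lipschitz

variable (X : Type*) [MetricSpace X]

/-- The vector space of real-valued Lipschitz functions on `X`, as a subspace of `X → ℝ`. -/
def lipSubmodule : Submodule ℝ (X → ℝ) where
  carrier := {φ | ∃ C : ℝ, ∀ x y, |φ x - φ y| ≤ C * dist x y}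
  zero_mem' := ⟨0, by simp⟩
  add_mem' := by
    rintro φ ψ ⟨C, hC⟩ ⟨D, hD⟩
    refine ⟨C + D, fun x y => ?_⟩
    have e : (φ + ψ) x - (φ + ψ) y = (φ x - φ y) + (ψ x - ψ y) := by
      simp only [Pi.add_apply]; ring
    rw [e, add_mul]
    exact (abs_add_le _ _).trans (add_le_add (hC x y) (hD x y))
  smul_mem' := by
    rintro c φ ⟨C, hC⟩
    refine ⟨|c| * C, fun x y => ?_⟩
    have e : (c • φ) x - (c • φ) y = c * (φ x - φ y) := by
      simp only [Pi.smul_apply, smul_eq_mul]; ring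
    rw [e, abs_mul, mul_assoc]
    exact mul_le_mul_of_nonneg_left (hC x y) (abs_nonneg c)

/-- The space `Lip X` of real-valued Lipschitz functions on `X`; it carries the seminorm `L` below
and not the topology of pointwise convergence. -/
def LipFun : Type _ := lipSubmodule X

variable {X}

namespace LipFun

instance : AddCommGroup (LipFun X) := inferInstanceAs (AddCommGroup (lipSubmodule X))

instance : Module ℝ (LipFun X) := inferInstanceAs (Module ℝ (lipSubmodule X))

instance : FunLike (LipFun X) X ℝ where
  coe φ := Subtype.val φ
  coe_injective := Subtype.val_injective

theorem add_apply (φ ψ : LipFun X) (x : X) : (φ + ψ) x = φ x + ψ x := rfl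

theorem smul_apply (c : ℝ) (φ : LipFun X) (x : X) : (c • φ) x = c * φ x := rfl

/-- The optimal Lipschitz constant `L(φ) = sup_{x ≠ y} |φ x - φ y| / d(x, y)`
(pairs with `x = y` contribute `0 / 0 = 0`). -/
def L (φ : LipFun X) : ℝ := ⨆ p : X × X, |φ p.1 - φ p.2| / dist p.1 p.2

theorem bddAbove_slopes (φ : LipFun X) :
    BddAbove (Set.range fun p : X × X => |φ p.1 - φ p.2| / dist p.1 p.2) := by
  obtain ⟨C, hC⟩ : ∃ C : ℝ, ∀ x y, |φ x - φ y| ≤ C * dist x y := φ.2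
  refine ⟨max C 0, ?_⟩
  rintro _ ⟨⟨x, y⟩, rfl⟩
  exact div_le_of_le_mul₀ dist_nonneg (le_max_right _ _)
    ((hC x y).trans (mul_le_mul_of_nonneg_right (le_max_left _ _) dist_nonneg))

theorem L_nonneg (φ : LipFun X) : 0 ≤ L φ :=
  Real.iSup_nonneg fun _ => div_nonneg (abs_nonneg _) dist_nonneg

theorem abs_sub_le (φ : LipFun X) (x y : X) : |φ x - φ y| ≤ L φ * dist x y := by
  rcases eq_or_ne x y with rfl | h
  · simp
  · exact (div_le_iff₀ (dist_pos.2 h)).1 (le_ciSup (bddAbove_slopes φ) (x, y))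

theorem L_le {φ : LipFun X} {C : ℝ} (hC : 0 ≤ C) (h : ∀ x y, |φ x - φ y| ≤ C * dist x y) :
    L φ ≤ C :=
  Real.iSup_le (fun p => div_le_of_le_mul₀ dist_nonneg hC (h p.1 p.2)) hC

/-- `L` as a seminorm on `Lip X`. -/
def lipSeminorm : Seminorm ℝ (LipFun X) :=
  Seminorm.ofSMulLE L
    (le_antisymm (L_le le_rfl fun x y => by
      have : ∀ z, (0 : LipFun X) z = 0 := fun _ => rfl
      simp [this]) (L_nonneg _))
    (fun φ ψ => L_le (add_nonneg (L_nonneg _) (L_nonneg _)) fun x y => by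
      have e : (φ + ψ) x - (φ + ψ) y = (φ x - φ y) + (ψ x - ψ y) := by
        simp only [add_apply]; ring
      rw [e, add_mul]
      exact (abs_add_le _ _).trans (add_le_add (abs_sub_le φ x y) (abs_sub_le ψ x y)))
    (fun c φ => L_le (mul_nonneg (norm_nonneg _) (L_nonneg _)) fun x y => by
      have e : (c • φ) x - (c • φ) y = c * (φ x - φ y) := by
        simp only [smul_apply]; ring
      rw [e, abs_mul, mul_assoc, Real.norm_eq_abs]
      exact mul_le_mul_of_nonneg_left (abs_sub_le φ x y) (abs_nonneg c))

instance : SeminormedAddCommGroup (LipFun X) :=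
  (lipSeminorm (X := X)).toAddGroupSeminorm.toSeminormedAddCommGroup

theorem norm_def (φ : LipFun X) : ‖φ‖ = L φ := rfl

instance : NormedSpace ℝ (LipFun X) where
  norm_smul_le c φ := (map_smul_eq_mul (lipSeminorm (X := X)) c φ).le

variable (X) in
/-- The subspace of constant functions. -/
def constants : Submodule ℝ (LipFun X) where
  carrier := {φ | ∃ c : ℝ, ∀ x, φ x = c}
  zero_mem' := ⟨0, fun _ => rfl⟩
  add_mem' := by
    rintro φ ψ ⟨c, hc⟩ ⟨d, hd⟩
    exact ⟨c + d, fun x => by rw [add_apply, hc, hd]⟩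
  smul_mem' := by
    rintro a φ ⟨c, hc⟩
    exact ⟨a * c, fun x => by rw [smul_apply, hc]⟩

theorem mem_constants_iff (φ : LipFun X) : φ ∈ constants X ↔ ‖φ‖ = 0 := by
  constructor
  · rintro ⟨c, hc⟩
    exact le_antisymm (L_le le_rfl fun x y => by simp [hc]) (L_nonneg _)
  · intro h
    have h0 : ∀ x y, φ x = φ y := fun x y => by
      have h1 := abs_sub_le φ x y
      rw [← norm_def, h, zero_mul] at h1
      exact sub_eq_zero.1 (abs_eq_zero.1 (le_antisymm h1 (abs_nonneg _)))
    rcases isEmpty_or_nonempty X with hX | ⟨⟨x₀⟩⟩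
    · exact ⟨0, fun x => hX.elim x⟩
    · exact ⟨φ x₀, fun x => h0 x x₀⟩

instance : IsClosed ((constants X : Submodule ℝ (LipFun X)) : Set (LipFun X)) := by
  have : ((constants X : Submodule ℝ (LipFun X)) : Set (LipFun X)) = norm ⁻¹' {0} := by
    ext φ
    exact mem_constants_iff φ
  rw [this]
  exact isClosed_singleton.preimage continuous_norm

end LipFun

variable (X) in
/-- `𝔏ip X = Lip X / {constant functions}` with the norm induced by `L` (the quotient norm; as `L`
is unchanged by adding constants, the norm of the class of `φ` is `L φ`, see
`LipMod.norm_mk`). -/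
abbrev LipMod : Type _ := LipFun X ⧸ LipFun.constants X

/-- The class of a Lipschitz function modulo constants. -/
def LipMod.mk : LipFun X →ₗ[ℝ] LipMod X := (LipFun.constants X).mkQ

theorem LipMod.norm_mk (φ : LipFun X) : ‖LipMod.mk φ‖ = LipFun.L φ := by
  refine le_antisymm (Submodule.Quotient.norm_mk_le _ φ) ?_
  refine le_of_forall_pos_le_add fun ε hε => ?_
  obtain ⟨ψ, h1, h2⟩ := Submodule.Quotient.norm_mk_lt (LipMod.mk φ) hε
  have h3 : φ - ψ ∈ LipFun.constants X := by
    rw [← Submodule.Quotient.eq]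
    exact h1.symm
  have h4 := (LipFun.mem_constants_iff _).1 h3
  have h5 := norm_add_le (φ - ψ) ψ
  rw [sub_add_cancel, h4, zero_add] at h5
  rw [← LipFun.norm_def]
  linarith

end Lipschitz

/-! ### Isometric actions: translation of Lipschitz functions and the space of orbit closures -/

section Action

variable {G X : Type*} [Group G] [MetricSpace X] [MulAction G X] [IsIsometricSMul G X]

/-- The translate `φ (g⁻¹ ·)` of a Lipschitz function `φ`. -/
def LipFun.translate (g : G) (φ : LipFun X) : LipFun X :=
  ⟨fun x => φ (g⁻¹ • x), LipFun.L φ, fun x y => by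
    simpa using LipFun.abs_sub_le φ (g⁻¹ • x) (g⁻¹ • y)⟩

variable (G X)

/-- `X//G`: the set of closures of `G`-orbits on `X`. -/
def OrbitClosures : Type _ := Set.range fun x : X => closure (MulAction.orbit G x)

variable {X}

/-- The closure of the orbit of `x`, as a point of `X//G`. -/
def OrbitClosures.mk (x : X) : OrbitClosures G X := ⟨closure (MulAction.orbit G x), x, rfl⟩

variable {G}

theorem OrbitClosures.hausdorffEDist_ne_top (a b : OrbitClosures G X) :
    Metric.hausdorffEDist a.1 b.1 ≠ ⊤ := by
  obtain ⟨_, x, rfl⟩ := a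
  obtain ⟨_, y, rfl⟩ := b
  refine ne_top_of_le_ne_top (edist_ne_top x y) ?_
  simp only [Metric.hausdorffEDist_closure]
  refine Metric.hausdorffEDist_le_of_mem_edist ?_ ?_
  · rintro _ ⟨g, rfl⟩
    exact ⟨g • y, ⟨g, rfl⟩, (edist_smul_left g x y).le⟩
  · rintro _ ⟨g, rfl⟩
    exact ⟨g • x, ⟨g, rfl⟩, by rw [edist_comm]; exact (edist_smul_left g x y).le⟩

/-- `X//G` with the Hausdorff distance. -/
instance : MetricSpace (OrbitClosures G X) where
  dist a b := Metric.hausdorffDist a.1 b.1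
  dist_self _ := Metric.hausdorffDist_self_zero
  dist_comm _ _ := Metric.hausdorffDist_comm
  dist_triangle a b _ := Metric.hausdorffDist_triangle (a.hausdorffEDist_ne_top b)
  eq_of_dist_eq_zero {a b} h := Subtype.ext <|
    (IsClosed.hausdorffDist_zero_iff_eq (by obtain ⟨_, x, rfl⟩ := a; exact isClosed_closure)
      (by obtain ⟨_, x, rfl⟩ := b; exact isClosed_closure) (a.hausdorffEDist_ne_top b)).1 h

end Action

end

/-! ### Bi-invariant means -/

namespace LUCB

/-! Average `φ` over orbits. Although `g ↦ φ (g • x)` may be unbounded, the increment `g ↦ φ (g • x)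
- φ (g • y)` lies in `LUCB G` and is bounded by `L φ * dist x y`. Applying a mean `m` with `y = x₀`
fixed gives a function of `x` with Lipschitz constant at most `L φ`; another base point changes it
by a constant only. If `m` is `ρ`-invariant, the mean increment from `x` to `g • x` is a continuous
homomorphism in `g` (`mean_orbitDiff_mul_smul`, `meanIncrement`). Either hypothesis kills it
(`mean_orbitDiff_smul_self`), so the average is constant on orbits and descends to `X//G`.
`λ`-invariance of `m` makes the result blind to translating `φ`. Both invariances are needed at
once, whence `exists_biinvariant_mean`. -/

theorem ext_apply {G : Type*} [Group G] [TopologicalSpace G] {φ ψ : LUCB G}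
    (h : ∀ g, φ.1 g = ψ.1 g) : φ = ψ := Subtype.ext (funext h)

variable {G : Type*} [Group G] [TopologicalSpace G] [IsTopologicalGroup G]

theorem rho_add (g : G) (φ ψ : LUCB G) : rho g (φ + ψ) = rho g φ + rho g ψ := rfl

theorem rho_smul (g : G) (c : ℝ) (φ : LUCB G) : rho g (c • φ) = c • rho g φ := rfl

theorem rho_rho (g h : G) (φ : LUCB G) : rho g (rho h φ) = rho (g * h) φ :=
  ext_apply fun x => congrArg φ.1 (mul_assoc x g h)

theorem rho_lam (g h : G) (φ : LUCB G) : rho g (lam h φ) = lam h (rho g φ) :=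
  ext_apply fun x => congrArg φ.1 (mul_assoc h⁻¹ x g).symm

/-- For a mean `n`, the function `h ↦ n (φ (· h))`, linear in `φ`. -/
def meanOrbit (n : LUCB G →ₗ[ℝ] ℝ) (hn : IsMean n) : LUCB G →ₗ[ℝ] LUCB G where
  toFun φ := ⟨fun h => n (rho h φ), by
    obtain ⟨⟨C, hC⟩, hφ⟩ := φ.2
    refine ⟨⟨C, fun h => hn.abs_apply_le _ C fun x => hC _⟩, fun ε hε => ?_⟩
    obtain ⟨V, hV, hVε⟩ := hφ (ε / 2) (half_pos hε)
    refine ⟨V, hV, fun h v hv => ?_⟩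
    -- The modulus of continuity of `φ` is uniform over all `x * h`, so it survives the mean; `ε /
    -- 2` restores strictness.
    rw [← map_sub]
    refine (hn.abs_apply_le _ (ε / 2) fun x => ?_).trans_lt (half_lt_self hε)
    have := (hVε (x * h) v hv).le
    rwa [mul_assoc] at this⟩
  map_add' φ ψ := ext_apply fun h => by
    simp only [rho_add, map_add, Submodule.coe_add, Pi.add_apply]
  map_smul' c φ := ext_apply fun h => by
    simp only [rho_smul, map_smul, Submodule.coe_smul, Pi.smul_apply, RingHom.id_apply]

/-- An amenable and skew-amenable group has a bi-invariant mean. -/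
theorem exists_biinvariant_mean (hamen : IsAmenableGroup G) (hskew : IsSkewAmenableGroup G) :
    ∃ m : LUCB G →ₗ[ℝ] ℝ, IsMean m ∧ (∀ (g : G) (φ : LUCB G), m (rho g φ) = m φ) ∧
      ∀ (g : G) (φ : LUCB G), m (lam g φ) = m φ := by
  obtain ⟨m, hm, hρ⟩ := hamen
  obtain ⟨n, hn, hl⟩ := hskew
  -- The inner `n` absorbs left translations, as these commute with right ones; `meanOrbit`
  -- intertwines `ρ`, so the outer `m` absorbs right translations.
  refine ⟨m ∘ₗ meanOrbit n hn, ⟨fun φ hφ => hm.nonneg _ fun h => hn.nonneg _ fun x => hφ _, ?_⟩,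
    fun g φ => ?_, fun g φ => ?_⟩
  · have : meanOrbit n hn one = one := ext_apply fun h => hn.map_one
    rw [LinearMap.comp_apply, this, hm.map_one]
  · have : meanOrbit n hn (rho g φ) = rho g (meanOrbit n hn φ) :=
      ext_apply fun h => congrArg n (rho_rho h g φ)
    rw [LinearMap.comp_apply, this, hρ, LinearMap.comp_apply]
  · have : meanOrbit n hn (lam g φ) = meanOrbit n hn φ :=
      ext_apply fun h => (congrArg n (rho_lam h g φ)).trans (hl g _)
    rw [LinearMap.comp_apply, this, LinearMap.comp_apply]

end LUCB

/-- A bounded homomorphism into the reals vanishes. -/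
theorem eq_zero_of_map_mul_eq_add_of_bounded {G : Type*} [Group G] {f : G → ℝ}
    (hf : ∀ g h, f (g * h) = f g + f h) {C : ℝ} (hC : ∀ g, |f g| ≤ C) (g : G) : f g = 0 := by
  have hpow : ∀ k : ℕ, f (g ^ (k + 1)) = (k + 1) * f g := fun k => by
    induction k with
    | zero => simp
    | succ k ih => rw [pow_succ, hf, ih]; push_cast; ring
  by_contra h0
  obtain ⟨k, hk⟩ := exists_nat_gt (C / |f g|)
  rw [div_lt_iff₀ (abs_pos.2 h0)] at hk
  have := hC (g ^ (k + 1))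
  rw [hpow, abs_mul, abs_of_nonneg (by positivity : (0 : ℝ) ≤ k + 1)] at this
  nlinarith [abs_nonneg (f g)]

namespace LipFun

theorem ext_apply {X : Type*} [MetricSpace X] {φ ψ : LipFun X} (h : ∀ x, φ x = ψ x) : φ = ψ :=
  DFunLike.ext _ _ h

theorem continuous {X : Type*} [MetricSpace X] (φ : LipFun X) : Continuous φ :=
  (LipschitzWith.of_dist_le' (K := L φ) fun x y => by
    rw [Real.dist_eq]; exact abs_sub_le φ x y).continuous

theorem abs_smul_sub_smul_le {G X : Type*} [Group G] [MetricSpace X] [MulAction G X]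
    [IsIsometricSMul G X] (φ : LipFun X) (g : G) (x y : X) :
    |φ (g • x) - φ (g • y)| ≤ L φ * dist x y := by
  simpa using abs_sub_le φ (g • x) (g • y)

/-! ### Averaging increments along orbits -/

section OrbitDiff

variable {G X : Type*} [Group G] [TopologicalSpace G]
  [MetricSpace X] [MulAction G X] [IsIsometricSMul G X] [ContinuousSMul G X]

variable (G) in
/-- The function `g ↦ φ (g x) - φ (g y)`. -/
def orbitDiff (φ : LipFun X) (x y : X) : LUCB G :=
  ⟨fun g => φ (g • x) - φ (g • y), ⟨L φ * dist x y, fun g => abs_smul_sub_smul_le φ g x y⟩,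
    fun ε hε => by
      -- Since `g` acts isometrically, this bound on the variation depends on `v` alone.
      have hc : Continuous fun v : G => L φ * dist (v • x) x + L φ * dist (v • y) y := by fun_prop
      have h1 := hc.tendsto 1
      simp only [one_smul, dist_self, mul_zero, add_zero] at h1
      refine ⟨_, h1 (Iio_mem_nhds hε), fun g v hv => ?_⟩
      refine lt_of_le_of_lt ?_ hv
      have e : φ ((g * v) • x) - φ ((g * v) • y) - (φ (g • x) - φ (g • y)) =
          (φ (g • v • x) - φ (g • x)) - (φ (g • v • y) - φ (g • y)) := by
        simp only [mul_smul]; ring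
      rw [e]
      exact (abs_sub _ _).trans
        (add_le_add (abs_smul_sub_smul_le φ g _ _) (abs_smul_sub_smul_le φ g _ _))⟩

theorem orbitDiff_add_orbitDiff (φ : LipFun X) (x y z : X) :
    orbitDiff G φ x y + orbitDiff G φ y z = orbitDiff G φ x z :=
  LUCB.ext_apply fun _ => sub_add_sub_cancel _ _ _

theorem orbitDiff_add (φ ψ : LipFun X) (x y : X) :
    orbitDiff G (φ + ψ) x y = orbitDiff G φ x y + orbitDiff G ψ x y :=
  LUCB.ext_apply fun _ => add_sub_add_comm _ _ _ _

theorem orbitDiff_smul (c : ℝ) (φ : LipFun X) (x y : X) :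
    orbitDiff G (c • φ) x y = c • orbitDiff G φ x y :=
  LUCB.ext_apply fun _ => (mul_sub _ _ _).symm

theorem lam_orbitDiff (h : G) (φ : LipFun X) (x y : X) :
    LUCB.lam h (orbitDiff G φ x y) = orbitDiff G (φ.translate h) x y :=
  LUCB.ext_apply fun g => by
    change φ ((h⁻¹ * g) • x) - φ ((h⁻¹ * g) • y) = φ (h⁻¹ • g • x) - φ (h⁻¹ • g • y)
    simp only [mul_smul]

theorem orbitDiff_of_invariant {φ : LipFun X} (hφ : ∀ (g : G) (x : X), φ (g • x) = φ x)
    (x y : X) : orbitDiff G φ x y = (φ x - φ y) • LUCB.one :=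
  LUCB.ext_apply fun g => by
    change φ (g • x) - φ (g • y) = (φ x - φ y) * 1
    rw [hφ, hφ, mul_one]

variable {m : LUCB G →ₗ[ℝ] ℝ}

theorem mean_orbitDiff_sub (φ : LipFun X) (x y z : X) :
    m (orbitDiff G φ x z) - m (orbitDiff G φ y z) = m (orbitDiff G φ x y) := by
  rw [← orbitDiff_add_orbitDiff φ x y z, map_add, add_sub_cancel_right]

variable [IsTopologicalGroup G]

theorem rho_orbitDiff (h : G) (φ : LipFun X) (x y : X) :
    LUCB.rho h (orbitDiff G φ x y) = orbitDiff G φ (h • x) (h • y) :=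
  LUCB.ext_apply fun g => by
    change φ ((g * h) • x) - φ ((g * h) • y) = φ (g • h • x) - φ (g • h • y)
    simp only [mul_smul]

theorem abs_mean_orbitDiff_le (hm : LUCB.IsMean m) (φ : LipFun X) (x y : X) :
    |m (orbitDiff G φ x y)| ≤ L φ * dist x y :=
  hm.abs_apply_le _ _ fun g => abs_smul_sub_smul_le φ g x y

/-- Pass through `g • x`: the increment from `g • x` to `g • h • x` is the `ρ g`-translate of the
one from `x` to `h • x`, so it has the same mean. -/
theorem mean_orbitDiff_mul_smul (hρ : ∀ (g : G) (φ : LUCB G), m (LUCB.rho g φ) = m φ)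
    (φ : LipFun X) (x : X) (g h : G) :
    m (orbitDiff G φ ((g * h) • x) x) =
      m (orbitDiff G φ (g • x) x) + m (orbitDiff G φ (h • x) x) := by
  rw [← orbitDiff_add_orbitDiff φ _ (g • x) x, map_add, mul_smul, ← rho_orbitDiff, hρ, add_comm]

/-- The mean increment of `φ` along an orbit is a continuous homomorphism `G → ℝ`. -/
def meanIncrement (hm : LUCB.IsMean m) (hρ : ∀ (g : G) (φ : LUCB G), m (LUCB.rho g φ) = m φ)
    (φ : LipFun X) (x : X) : G →ₜ* Multiplicative ℝ where
  toFun g := Multiplicative.ofAdd (m (orbitDiff G φ (g • x) x))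
  map_one' := by
    have h := mean_orbitDiff_mul_smul hρ φ x 1 1
    rw [mul_one] at h
    rw [left_eq_add.1 h, ofAdd_zero]
  map_mul' g h := by rw [mean_orbitDiff_mul_smul hρ, ofAdd_add]
  continuous_toFun := by
    refine continuous_ofAdd.comp (continuous_iff_continuousAt.2 fun g => ?_)
    refine tendsto_iff_dist_tendsto_zero.2 (squeeze_zero (fun _ => dist_nonneg)
      (g := fun h : G => L φ * dist (h • x) (g • x)) (fun h => ?_) ?_)
    · rw [Real.dist_eq, mean_orbitDiff_sub]
      exact abs_mean_orbitDiff_le hm φ _ _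
    · have hc : Continuous fun h : G => L φ * dist (h • x) (g • x) := by fun_prop
      simpa using hc.tendsto g

/-- With finite diameter the homomorphism is bounded by `L φ` times a bound for distances, hence
zero. -/
theorem mean_orbitDiff_smul_self (hm : LUCB.IsMean m)
    (hρ : ∀ (g : G) (φ : LUCB G), m (LUCB.rho g φ) = m φ)
    (h : Bornology.IsBounded (Set.univ : Set X) ∨ ∀ χ : G →ₜ* Multiplicative ℝ, χ = 1)
    (φ : LipFun X) (g : G) (x : X) : m (orbitDiff G φ (g • x) x) = 0 := by
  rcases h with h | h
  · obtain ⟨C, hC⟩ := Metric.isBounded_iff.1 h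
    exact eq_zero_of_map_mul_eq_add_of_bounded (f := fun g => m (orbitDiff G φ (g • x) x))
      (mean_orbitDiff_mul_smul hρ φ x)
      (fun g => (abs_mean_orbitDiff_le hm φ _ _).trans
        (mul_le_mul_of_nonneg_left (hC trivial trivial) (L_nonneg φ))) g
  · exact Multiplicative.ofAdd.injective (DFunLike.congr_fun (h (meanIncrement hm hρ φ x)) g)

/-- The averaged function `x ↦ m (g ↦ φ (g x) - φ (g x₀))`. -/
def average (hm : LUCB.IsMean m) (x₀ : X) (φ : LipFun X) : LipFun X :=
  ⟨fun x => m (orbitDiff G φ x x₀), L φ, fun x y => by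
    rw [mean_orbitDiff_sub]
    exact abs_mean_orbitDiff_le hm φ x y⟩

theorem average_apply (hm : LUCB.IsMean m) (x₀ : X) (φ : LipFun X) (x : X) :
    average hm x₀ φ x = m (orbitDiff G φ x x₀) := rfl

theorem L_average_le (hm : LUCB.IsMean m) (x₀ : X) (φ : LipFun X) :
    L (average hm x₀ φ) ≤ L φ :=
  L_le (L_nonneg φ) fun x y => by
    rw [average_apply, average_apply, mean_orbitDiff_sub]
    exact abs_mean_orbitDiff_le hm φ x y

end OrbitDiff

theorem eq_of_mem_closure_orbit {G X : Type*} [Group G] [MetricSpace X] [MulAction G X]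
    {φ : LipFun X} (hφ : ∀ (g : G) (x : X), φ (g • x) = φ x)
    {x y : X} (hy : y ∈ closure (MulAction.orbit G x)) : φ y = φ x := by
  refine closure_minimal ?_ (isClosed_eq φ.continuous continuous_const) hy
  rintro _ ⟨g, rfl⟩
  exact hφ g x

/-! ### Descent to the space of orbit closures -/

section Descend

variable {G X : Type*} [Group G] [MetricSpace X] [MulAction G X] [IsIsometricSMul G X]

theorem abs_sub_le_dist_mk {φ : LipFun X} (hφ : ∀ (g : G) (x : X), φ (g • x) = φ x) (x y : X) :
    |φ x - φ y| ≤ L φ * dist (OrbitClosures.mk G x) (OrbitClosures.mk G y) := by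
  refine le_of_forall_pos_le_add fun ε hε => ?_
  -- The `+ 1` guards against `L φ = 0` when dividing.
  have hL : 0 < L φ + 1 := by linarith [L_nonneg φ]
  have hlt : Metric.hausdorffDist (closure (MulAction.orbit G x)) (closure (MulAction.orbit G y)) <
      dist (OrbitClosures.mk G x) (OrbitClosures.mk G y) + ε / (L φ + 1) :=
    lt_add_of_pos_right _ (div_pos hε hL)
  obtain ⟨z, hz, hxz⟩ := Metric.exists_dist_lt_of_hausdorffDist_lt
    (subset_closure (MulAction.mem_orbit_self x)) hlt
    (OrbitClosures.hausdorffEDist_ne_top (OrbitClosures.mk G x) (OrbitClosures.mk G y))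
  rw [← eq_of_mem_closure_orbit hφ hz]
  refine (abs_sub_le φ x z).trans ((mul_le_mul_of_nonneg_left hxz.le (L_nonneg φ)).trans ?_)
  rw [mul_add]
  refine add_le_add le_rfl ?_
  rw [← mul_div_assoc, div_le_iff₀ hL]
  nlinarith

/-- The function on `X//G` induced by an invariant Lipschitz function on `X`. -/
noncomputable def descend (φ : LipFun X) (hφ : ∀ (g : G) (x : X), φ (g • x) = φ x) :
    LipFun (OrbitClosures G X) :=
  ⟨fun a => φ a.2.choose, L φ, fun a b => by
    have e : ∀ c : OrbitClosures G X, OrbitClosures.mk G c.2.choose = c :=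
      fun c => Subtype.ext c.2.choose_spec
    have := abs_sub_le_dist_mk hφ a.2.choose b.2.choose
    rwa [e a, e b] at this⟩

/-- The chosen representative need not lie in the orbit of `x`, only in its closure, so continuity
of `φ` is used. -/
theorem descend_mk (φ : LipFun X) (hφ : ∀ (g : G) (x : X), φ (g • x) = φ x) (x : X) :
    descend φ hφ (OrbitClosures.mk G x) = φ x := by
  refine eq_of_mem_closure_orbit hφ ?_
  have h : closure (MulAction.orbit G (OrbitClosures.mk G x).2.choose) =
      closure (MulAction.orbit G x) := (OrbitClosures.mk G x).2.choose_spec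
  exact h ▸ subset_closure (MulAction.mem_orbit_self _)

theorem L_descend_le (φ : LipFun X) (hφ : ∀ (g : G) (x : X), φ (g • x) = φ x) :
    L (descend φ hφ) ≤ L φ :=
  L_le (L_nonneg φ) fun a b => by
    obtain ⟨_, x, rfl⟩ := a
    obtain ⟨_, y, rfl⟩ := b
    have := abs_sub_le_dist_mk hφ x y
    rwa [← descend_mk φ hφ x, ← descend_mk φ hφ y] at this

theorem ext_orbitClosures {φ ψ : LipFun (OrbitClosures G X)}
    (h : ∀ x : X, φ (OrbitClosures.mk G x) = ψ (OrbitClosures.mk G x)) : φ = ψ :=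
  ext_apply fun a => by
    obtain ⟨_, x, rfl⟩ := a
    exact h x

end Descend

end LipFun

/-- A contractive linear map on Lipschitz functions induces a contraction modulo constants. -/
theorem LipMod.exists_lift {X Y : Type*} [MetricSpace X] [MetricSpace Y]
    (T : LipFun X →ₗ[ℝ] LipFun Y) (hT : ∀ φ, LipFun.L (T φ) ≤ LipFun.L φ) :
    ∃ S : LipMod X →L[ℝ] LipMod Y, ‖S‖ ≤ 1 ∧
      ∀ φ, S (LipMod.mk φ) = LipMod.mk (T φ) := by
  -- Constants are exactly the functions of seminorm zero, which a contraction preserves.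
  have hker : LipFun.constants X ≤ (LipFun.constants Y).comap T := fun φ hφ => by
    rw [LipFun.mem_constants_iff] at hφ
    rw [Submodule.mem_comap, LipFun.mem_constants_iff]
    exact le_antisymm ((hT φ).trans hφ.le) (norm_nonneg _)
  have hbound : ∀ q : LipMod X, ‖Submodule.mapQ _ _ T hker q‖ ≤ 1 * ‖q‖ := fun q => by
    obtain ⟨φ, rfl⟩ := Submodule.mkQ_surjective _ q
    change ‖LipMod.mk (T φ)‖ ≤ 1 * ‖LipMod.mk φ‖
    rw [LipMod.norm_mk, LipMod.norm_mk, one_mul]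
    exact hT φ
  exact ⟨LinearMap.mkContinuous _ 1 hbound, LinearMap.mkContinuous_norm_le _ zero_le_one hbound,
    fun φ => rfl⟩

theorem LipMod.mk_eq_mk_of_sub_const {X : Type*} [MetricSpace X] {φ ψ : LipFun X} {c : ℝ}
    (h : ∀ x, φ x = ψ x - c) : LipMod.mk φ = LipMod.mk ψ := by
  refine (Submodule.Quotient.eq _).2 ⟨-c, fun x => ?_⟩
  change φ x - ψ x = -c
  rw [h]
  ring

/-! ### The averaging operator -/

theorem mainTheorem5
    {G : Type*} [Group G] [TopologicalSpace G] [IsTopologicalGroup G]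
    {X : Type*} [MetricSpace X] [MulAction G X] [IsIsometricSMul G X] [ContinuousSMul G X]
    (hamen : IsAmenableGroup G) (hskew : IsSkewAmenableGroup G)
    (h : Bornology.IsBounded (Set.univ : Set X) ∨ ∀ χ : G →ₜ* Multiplicative ℝ, χ = 1) :
    ∃ S : LipMod X →L[ℝ] LipMod (OrbitClosures G X),
      ‖S‖ ≤ 1 ∧
      (∀ (g : G) (φ : LipFun X), S (LipMod.mk (φ.translate g)) = S (LipMod.mk φ)) ∧
      ∀ φ : LipFun X, (∀ (g : G) (x : X), φ (g • x) = φ x) →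
        ∃ ψ : LipFun (OrbitClosures G X),
          S (LipMod.mk φ) = LipMod.mk ψ ∧ ∀ x : X, ψ (OrbitClosures.mk G x) = φ x := by
  rcases isEmpty_or_nonempty X with hX | ⟨⟨x₀⟩⟩
  -- Without a base point, the zero operator serves.
  · obtain ⟨S, hS, hST⟩ := LipMod.exists_lift (0 : LipFun X →ₗ[ℝ] LipFun (OrbitClosures G X))
      fun φ => (norm_zero (E := LipFun (OrbitClosures G X))).le.trans (LipFun.L_nonneg φ)
    exact ⟨S, hS, fun g φ => (hST (φ.translate g)).trans (hST φ).symm,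
      fun φ _ => ⟨0, hST φ, fun x => hX.elim x⟩⟩
  obtain ⟨m, hm, hρ, hl⟩ := LUCB.exists_biinvariant_mean hamen hskew
  have hinv : ∀ (φ : LipFun X) (g : G) (x : X),
      LipFun.average hm x₀ φ (g • x) = LipFun.average hm x₀ φ x := fun φ g x => by
    rw [← sub_eq_zero, LipFun.average_apply, LipFun.average_apply, LipFun.mean_orbitDiff_sub]
    exact LipFun.mean_orbitDiff_smul_self hm hρ h φ g x
  let T : LipFun X →ₗ[ℝ] LipFun (OrbitClosures G X) :=
    { toFun := fun φ => LipFun.descend (LipFun.average hm x₀ φ) (hinv φ)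
      map_add' := fun φ ψ => LipFun.ext_orbitClosures fun x => by
        simp only [LipFun.add_apply, LipFun.descend_mk, LipFun.average_apply,
          LipFun.orbitDiff_add, map_add]
      map_smul' := fun c φ => LipFun.ext_orbitClosures fun x => by
        simp only [LipFun.smul_apply, LipFun.descend_mk, LipFun.average_apply,
          LipFun.orbitDiff_smul, map_smul, smul_eq_mul, RingHom.id_apply] }
  have hT : ∀ φ x, T φ (OrbitClosures.mk G x) = m (LipFun.orbitDiff G φ x x₀) :=
    fun φ x => LipFun.descend_mk _ (hinv φ) x
  obtain ⟨S, hS, hST⟩ := LipMod.exists_lift T fun φ =>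
    (LipFun.L_descend_le _ (hinv φ)).trans (LipFun.L_average_le hm x₀ φ)
  refine ⟨S, hS, fun g φ => ?_, fun φ hφ => ⟨LipFun.descend φ hφ, ?_, LipFun.descend_mk φ hφ⟩⟩
  · rw [hST, hST]
    refine congrArg _ (LipFun.ext_orbitClosures fun x => ?_)
    rw [hT, hT, ← LipFun.lam_orbitDiff, hl]
  · rw [hST]
    -- For invariant `φ` the increment is the constant `φ x - φ x₀`; the base value disappears
    -- modulo constants.
    refine LipMod.mk_eq_mk_of_sub_const (c := φ x₀) fun a => ?_
    obtain ⟨_, x, rfl⟩ := a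
    refine (hT φ x).trans ?_
    rw [LipFun.orbitDiff_of_invariant hφ, map_smul, hm.map_one, smul_eq_mul, mul_one]
    exact congrArg (· - φ x₀) (LipFun.descend_mk φ hφ x).symm
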